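/- **Setting.** Let $G=(V,E)$ be a finite multigraph (parallel edges and loops allowed), $f:V\to\mathbb N$, and $M\subseteq E$ an $f$-matching, i.e. $d(v,M)\le f(v)$ for all $v$ (a loop counts twice in $d$). A vertex $v$ is *free* if its deficiency $f(v)-d(v,M)$ is positive. The *M-type* of an edge is *matched* or *unmatched*. A trail is *alternating* if every two consecutive edges have opposite M-types (the last and first edge of a closed trail are not consecutive). An *augmenting trail* is a nonempty alternating trail whose first and last edges are unmatched and whose ends are free (of deficiency at least $2$ if the two ends coincide). Edge weights are $w(e)=2$ for $e\in M$ and $w(e)=0$ for $e\notin M$. *Blossoms* are defined recursively. Let $\overline G$ be obtained from $G$ by contracting a family $\mathcal A$ of vertex-disjoint blossoms (edges inside a contracted blossom disappear; uncontracted vertices are *atoms*), and let $C$ be a closed trail of $\overline G$ with at least one edge that starts and ends at $\alpha$. The preimage $B$ of $C$ in $G$, with vertex set $V(B)$ and edge set $E(B)$, is a blossom if: (i) if $\alpha$ is an atom, the first and last edges of $C$ have the same M-type; this is the M-type of $B$, and the base vertex is $\beta(B)=\alpha$; if $\alpha\in\mathcal A$, $B$ has the M-type of $\alpha$ and $\beta(B)=\beta(\alpha)$;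 (ii) every two consecutive edges of $C$ at an atom alternate; (iii) every $A\in\mathcal A$ on $C$ has degree $2$ in $C$, and if $A\neq\alpha$ then some edge of $C$ at the vertex $\beta(A)$ has M-type opposite to $A$. A blossom is *free* if its base vertex is free; a free blossom has M-type unmatched and its base vertex has deficiency $1$. Each blossom $A$ has a *base edge* $\eta(A)$ that leaves $V(A)$ from $\beta(A)$ and has M-type opposite to $A$; blossoms with the same base vertex have the same base edge. If $A$ is not free, and is on the closed trail $C$ of another blossom with $A\ne\alpha$, then $\eta(A)$ is the edge of $C$ required in (iii). If $A$ is free, $\eta(A)$ is an artificial matched edge from a dummy vertex $\varepsilon$ (in no blossom) to $\beta(A)$. Any other edge leaving $A$ is a *petal* of $A$. A *structured matching* consists of $M$, duals $y:V\to\mathbb R$ and $z:2^V\to\mathbb R_{\ge0}$, and a nested (laminar) family of blossoms, closed under passing to the blossoms they are built from, with base edges as above, such that every set with positive $z$-value is the vertex set of a blossom of the family (a *positive blossom*). With $$I(B)=\{e\in M: e\text{ leaves }V(B)\}\oplus\{\eta(B)\},\qquad \widehat{yz}(uv)=y(u)+y(v)+\sum\{z(B): uv\text{ has both ends in }V(B)\text{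 or } uv\in I(B)\},$$ it is required that $\widehat{yz}(e)\ge w(e)$ for unmatched $e$, $\widehat{yz}(e)\le w(e)$ for matched $e$, that every edge of $E(B)$, and $\eta(B)$ if it is an edge of $G$, is tight for each positive blossom $B$, and that all free vertices $\phi$ have the same value $y(\phi)$. An edge is *tight* if $\widehat{yz}(e)=w(e)$. **Petalevels.** An entrance sequence $\iota$ of $v$ assigns to each positive blossom $A\ni v$ a value $\iota_A\in\{b,p\}$. Put $z_c(v,\iota)=\sum\{z(A): v\in A,\ \iota_A=c\}$ and $$l_o(v,\iota)=y(v)-y(\phi)+z_p(v,\iota),\qquad l_i(v,\iota)=1-\bigl(y(v)+y(\phi)+z_b(v,\iota)\bigr).$$ For an edge $e$ let $j(\mu(e))=o$ if $e\in M$ and $i$ if $e\notin M$; $\overline j$ is the io-type opposite to $j$. An augmenting trail $T$ starting at $\phi$ is regarded as arriving at $\phi$ from $\varepsilon$ along the artificial edge $\varepsilon\phi$. When $T$ advances on $uv$, the *natural* entrance sequence is, for each positive blossom $A\ni v$: $\iota_A(v)=\iota_A(u)$ if $u\in A$; $\iota_A(v)=b$ if $u\notin A$ and $uv=\eta(A)$;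 $\iota_A(v)=p$ if $u\notin A$ and $uv\neq\eta(A)$. (Values refer to occurrences of vertices on $T$.) Given a collection $\mathcal T$ of pairwise edge-disjoint, arbitrarily oriented augmenting trails, the *shortened* entrance sequence along $T\in\mathcal T$ is: $\iota_A(v)=\iota_A(u)$ if $u\in A$; and for $u\notin A$, $\iota_A(v)=b$ if some trail of $\mathcal T$ enters $A$ on $\eta(A)$, and $\iota_A(v)=p$ otherwise. **Theorem.** Fix a structured matching. 1. (Natural petalevels.) Let $T$ be an augmenting trail that advances on an edge $uv$, and $j=j(\mu(uv))$. With natural entrance sequences, (a) $l_j(v,\iota(v))\le l_{\overline j}(u,\iota(u))+1$; (b) equality holds in (a) if and only if $uv$ is tight and it alternates at every positive blossom that it leaves, i.e. for every positive blossom $A$ with $u\in A\not\ni v$, either $\iota_A(u)=b$ or $uv=\eta(A)$. 2. (Shortened petalevels.) Let $\mathcal T$ be a collection of pairwise edge-disjoint oriented augmenting trails, and let $T\in\mathcal T$ advance on an edge $uv$, $j=j(\mu(uv))$. With shortened entrance sequences, $l_j(v,\iota(v))\le l_{\overline j}(u,\iota(u))+1$ still holds. -/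

import Mathlib

namespace FMatching

noncomputable section

variable {V E : Type*}

/-! ### Matchings in a multigraph (parallel edges and loops allowed) -/

/-- The edge `e` leaves the vertex set `X` : one end is in `X`, the other is not. -/
def Leaves (G : Graph V E) (e : E) (X : Finset V) : Prop :=
  ∃ x y, G.IsLink e x y ∧ x ∈ X ∧ y ∉ X

/-- `e ∈ γ(X)` : both ends of `e` are in `X`. -/
def Spanned (G : Graph V E) (e : E) (X : Finset V) : Prop :=
  ∃ x y, G.IsLink e x y ∧ x ∈ X ∧ y ∈ X

open Classical in
/-- `d(v, F)`, a loop at `v` counting twice. -/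
def deg (G : Graph V E) (F : Finset E) (v : V) : ℕ :=
  ∑ e ∈ F, ((if G.Inc e v then 1 else 0) + (if G.IsLoopAt e v then 1 else 0))

def IsFMatching (G : Graph V E) (f : V → ℕ) (M : Finset E) : Prop :=
  (∀ e ∈ M, e ∈ G.edgeSet) ∧ ∀ v ∈ G.vertexSet, deg G M v ≤ f v

/-- `v` is free, i.e. its deficiency `f v - d(v, M)` is positive. -/
def IsFree (G : Graph V E) (f : V → ℕ) (M : Finset E) (v : V) : Prop :=
  v ∈ G.vertexSet ∧ deg G M v < f v

/-! ### Trails -/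

/-- An oriented trail: consecutive edges, none repeated (vertices may repeat). -/
structure Trail (G : Graph V E) where
  length : ℕ
  vert : Fin (length + 1) → V
  edge : Fin length → E
  isLink : ∀ i : Fin length, G.IsLink (edge i) (vert i.castSucc) (vert i.succ)
  edge_injective : Function.Injective edge

namespace Trail

variable {G : Graph V E}

/-- Every two consecutive edges have opposite M-types. -/
def IsAlternating (T : Trail G) (M : Finset E) : Prop :=
  ∀ i k : Fin T.length, (k : ℕ) = i + 1 → (T.edge i ∈ M ↔ T.edge k ∉ M)

/-- An augmenting trail: a nonempty alternating trail whose first and last edges are unmatched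
and whose two ends are free; a closed one needs deficiency at least two at its end. -/
structure IsAugmenting (T : Trail G) (f : V → ℕ) (M : Finset E) : Prop where
  pos : 0 < T.length
  alternating : T.IsAlternating M
  first_unmatched : ∀ i : Fin T.length, (i : ℕ) = 0 → T.edge i ∉ M
  last_unmatched : ∀ i : Fin T.length, (i : ℕ) + 1 = T.length → T.edge i ∉ M
  start_free : IsFree G f M (T.vert 0)
  end_free : IsFree G f M (T.vert (Fin.last T.length))
  closed : T.vert 0 = T.vert (Fin.last T.length) → deg G M (T.vert 0) + 2 ≤ f (T.vert 0)

end Trail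

/-! ### Blossoms -/

/-- Nodes of contracted graphs. A node is an atom (a vertex of the graph), or a contracted
closed trail `node 0, edge 0, node 1, edge 1, …, node n, edge n, node 0` of previously
constructed nodes; indices are cyclic, `edge i` joining `node i` to `node (i + 1)`.
The trail starts and ends at `node 0`. -/
inductive Node (V E : Type*) where
  | atom (v : V) : Node V E
  | contract (n : ℕ) (node : Fin (n + 1) → Node V E) (edge : Fin (n + 1) → E) : Node V E

namespace Node

def IsAtom : Node V E → Prop
  | atom _ => True
  | contract _ _ _ => False

open Classical in
/-- The vertex set `V(B)` of the preimage. -/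
def verts : Node V E → Finset V
  | atom v => {v}
  | contract _ node _ => Finset.univ.biUnion fun i => (node i).verts

/-- The edge set `E(B)` of the preimage. -/
def edges : Node V E → Set E
  | atom _ => ∅
  | contract _ node edge => Set.range edge ∪ ⋃ i, (node i).edges

/-- The base vertex `β(B)`. -/
def base : Node V E → V
  | atom v => v
  | contract _ node _ => (node 0).base

/-- A blossom is heavy if its M-type is `M`, light if its M-type is the opposite one. The M-type
is that of the first edge if the trail starts at an atom, and is inherited from the contracted
blossom at which the trail starts otherwise. (Atoms have no M-type.) -/
def Heavy (M : Finset E) : Node V E → Prop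
  | atom _ => False
  | contract _ node edge => ((node 0).IsAtom ∧ edge 0 ∈ M) ∨ (node 0).Heavy M

/-- The edges of the closed trail of a blossom. -/
def trailEdges : Node V E → Set E
  | atom _ => ∅
  | contract _ _ edge => Set.range edge

/-- The blossoms that are contracted vertices of the closed trail of a blossom. -/
def parts : Node V E → Set (Node V E)
  | atom _ => ∅
  | contract _ node _ => {A | ¬ A.IsAtom ∧ ∃ i, node i = A}

/-- The node at which the closed trail of a blossom starts and ends. -/
def first : Node V E → Node V E
  | atom v => atom v
  | contract _ node _ => node 0

/-- The recursive conditions that define blossoms for the matching `M`. -/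
def Valid (G : Graph V E) (M : Finset E) : Node V E → Prop
  | atom v => v ∈ G.vertexSet
  | contract n node edge =>
      (∀ i, (node i).Valid G M) ∧
      -- different nodes have disjoint vertex sets
      (∀ i k, node i ≠ node k → Disjoint (node i).verts (node k).verts) ∧
      -- the edges form a closed trail of the contracted graph,
      -- in which the edges inside contracted blossoms have disappeared
      Function.Injective edge ∧
      (∀ i, ∃ x y, G.IsLink (edge i) x y ∧ x ∈ (node i).verts ∧ y ∈ (node (i + 1)).verts) ∧
      (∀ i k, ¬ (node k).IsAtom → ¬ Spanned G (edge i) (node k).verts) ∧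
      -- if the trail starts at an atom, then its first and last edges have the same M-type
      ((node 0).IsAtom → (edge 0 ∈ M ↔ edge (Fin.last n) ∈ M)) ∧
      -- two consecutive edges at an atom alternate (the last and first edge are not consecutive)
      (∀ i, i ≠ Fin.last n → (node (i + 1)).IsAtom → (edge i ∈ M ↔ edge (i + 1) ∉ M)) ∧
      -- a contracted blossom has degree 2 in the closed trail
      (∀ i, ¬ (node i).IsAtom → {k | Leaves G (edge k) (node i).verts}.ncard = 2) ∧
      -- a contracted blossom other than the starting node has, at its base vertex,
      -- an edge of the closed trail of opposite M-type
      (∀ i, ¬ (node i).IsAtom → node i ≠ node 0 →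
        ∃ k, G.Inc (edge k) (node i).base ∧ (edge k ∈ M ↔ ¬ (node i).Heavy M))

/-- `B` is a blossom with respect to the matching `M`. -/
def IsBlossom (G : Graph V E) (M : Finset E) (B : Node V E) : Prop :=
  ¬ B.IsAtom ∧ B.Valid G M

/-- `A` is `B` or one of the blossoms used in the recursive construction of `B`. -/
def IsSubblossom (A B : Node V E) : Prop :=
  Relation.ReflTransGen (fun A' B' : Node V E => A' ∈ B'.parts) A B

end Node

/-! ### Structured matchings

Edges that may serve as base edges are the edges of the graph (`Sum.inl e`) and, for every
vertex `v`, an artificial edge joining `v` to a dummy vertex `ε` outside the graph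
(`Sum.inr v`). -/

/-- The edge weights: `2` on matched edges and `0` on unmatched ones. -/
def weight (M : Finset E) (e : E) : ℝ :=
  open Classical in if e ∈ M then 2 else 0

/-- `e ∈ I(X) = δ(X, M) ⊕ η(X)`, `⊕` being symmetric difference. -/
def InI (G : Graph V E) (M : Finset E) (η : Finset V → E ⊕ V) (X : Finset V) (e : E) : Prop :=
  Xor (e ∈ M ∧ Leaves G e X) (η X = Sum.inl e)

open Classical in
/-- `ŷz(e) = y(e) + z{B | e ∈ γ(B) ∪ I(B)}` for an edge `e` with ends `u` and `v`. -/
def yzHat [Fintype V] (G : Graph V E) (M : Finset E) (η : Finset V → E ⊕ V)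
    (y : V → ℝ) (z : Finset V → ℝ) (e : E) (u v : V) : ℝ :=
  y u + y v + ∑ X : Finset V, if Spanned G e X ∨ InI G M η X e then z X else 0

/-- A structured matching for the edge weights `weight M`. -/
structure StructuredMatching [Fintype V] (G : Graph V E) (f : V → ℕ) where
  /-- the matching -/
  M : Finset E
  isFMatching : IsFMatching G f M
  /-- the dual variables -/
  y : V → ℝ
  z : Finset V → ℝ
  z_nonneg : ∀ X, 0 ≤ z X
  /-- the positive blossoms and the blossoms from which they are built -/
  blossoms : Set (Node V E)
  isBlossom : ∀ B ∈ blossoms, B.IsBlossom G M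
  parts_mem : ∀ B ∈ blossoms, ∀ A ∈ B.parts, A ∈ blossoms
  nested : ∀ A ∈ blossoms, ∀ B ∈ blossoms,
    A.IsSubblossom B ∨ B.IsSubblossom A ∨ Disjoint A.verts B.verts
  blossom_of_pos : ∀ X, 0 < z X → ∃ B ∈ blossoms, B.verts = X
  /-- `η (V(B))` is the base edge of the blossom `B` (irrelevant for other vertex sets) -/
  η : Finset V → E ⊕ V
  /-- blossoms with the same base vertex have the same base edge -/
  η_eq_of_base_eq : ∀ A ∈ blossoms, ∀ B ∈ blossoms, A.base = B.base → η A.verts = η B.verts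
  /-- the base edge leaves the blossom from the base vertex and has the opposite M-type -/
  η_of_not_free : ∀ B ∈ blossoms, ¬ IsFree G f M B.base →
    ∃ e x, η B.verts = Sum.inl e ∧ G.IsLink e B.base x ∧ x ∉ B.verts ∧ (e ∈ M ↔ ¬ B.Heavy M)
  /-- a free blossom is light, its base vertex has deficiency 1, and its base edge is the
  artificial edge at the base vertex -/
  η_of_free : ∀ B ∈ blossoms, IsFree G f M B.base →
    η B.verts = Sum.inr B.base ∧ ¬ B.Heavy M ∧ deg G M B.base + 1 = f B.base
  /-- the base edge of a contracted blossom on the closed trail of `B`, other than the one at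
  which the trail starts, is the edge required on that trail -/
  η_of_part : ∀ B ∈ blossoms, ∀ A ∈ B.parts, A ≠ B.first → ¬ IsFree G f M A.base →
    ∃ e ∈ B.trailEdges, η A.verts = Sum.inl e
  /-- unmatched edges are dominated -/
  dominated : ∀ e u v, G.IsLink e u v → e ∉ M → weight M e ≤ yzHat G M η y z e u v
  /-- matched edges are underrated -/
  underrated : ∀ e u v, G.IsLink e u v → e ∈ M → yzHat G M η y z e u v ≤ weight M e
  /-- the edges of a positive blossom and its base edge are tight -/
  tight_of_pos : ∀ B ∈ blossoms, 0 < z B.verts → ∀ e u v, G.IsLink e u v →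
    (e ∈ B.edges ∨ η B.verts = Sum.inl e) → yzHat G M η y z e u v = weight M e
  /-- all free vertices have the same `y`-value -/
  free_y : ∀ u v, IsFree G f M u → IsFree G f M v → y u = y v

/-! ### Entrance sequences and petalevels -/

/-- The io-types: inner and outer. -/
inductive IOType where
  | i
  | o

/-- The opposite io-type. -/
def IOType.opp : IOType → IOType
  | .i => .o
  | .o => .i

/-- The entrance values: a blossom is entered on its base edge, or on a petal. -/
inductive Mark where
  | b
  | p

namespace StructuredMatching

variable [Fintype V] {G : Graph V E} {f : V → ℕ}

/-- The edge `e` with ends `u` and `v` is tight. -/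
def IsTight (S : StructuredMatching G f) (e : E) (u v : V) : Prop :=
  yzHat G S.M S.η S.y S.z e u v = weight S.M e

open Classical in
/-- The io-type `j(μ(e))` of an edge along which one advances. -/
def ioType (S : StructuredMatching G f) (e : E) : IOType :=
  if e ∈ S.M then .o else .i

open Classical in
/-- `z_c(v, ι) = z{A | v ∈ A, ι_A = c}`. -/
def zMark (S : StructuredMatching G f) (c : Mark) (v : V) (ι : Finset V → Mark) : ℝ :=
  ∑ A : Finset V, if v ∈ A ∧ ι A = c then S.z A else 0

/-- The petalevel `l_j(v, ι)`, where `φ` is a free vertex. It depends only on the values of `ι`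
on the positive blossoms that contain `v`. -/
def petalevel (S : StructuredMatching G f) (φ : V) (j : IOType) (v : V)
    (ι : Finset V → Mark) : ℝ :=
  match j with
  | .o => S.y v - S.y φ + S.zMark .p v ι
  | .i => 1 - (S.y v + S.y φ + S.zMark .b v ι)

end StructuredMatching

namespace Trail

variable {G : Graph V E}

open Classical in
/-- The entrance value for `A` along `T`, at the `k`-th vertex of `T`: it is kept when `T`
advances from a vertex of `A`, and it is `new g` when `T` advances on the edge `g` from a vertex
outside `A`. The trail is considered to arrive at its first vertex from `ε`, on the artificial
edge. Only the values at vertices of `A` are meaningful. -/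
def entrance (T : Trail G) (A : Finset V) (new : E ⊕ V → Mark) : Fin (T.length + 1) → Mark :=
  Fin.induction (motive := fun _ => Mark) (new (Sum.inr (T.vert 0)))
    (fun i m => if T.vert i.castSucc ∈ A then m else new (Sum.inl (T.edge i)))

/-- `T`, preceded by the artificial edge from `ε` to its first vertex, enters `A` on `g`. -/
def EntersOn (T : Trail G) (A : Finset V) (g : E ⊕ V) : Prop :=
  (g = Sum.inr (T.vert 0) ∧ T.vert 0 ∈ A) ∨
    ∃ i : Fin T.length, g = Sum.inl (T.edge i) ∧ T.vert i.castSucc ∉ A ∧ T.vert i.succ ∈ A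

variable [Fintype V] {f : V → ℕ}

open Classical in
/-- The entrance sequence of natural petalevels, at the `k`-th vertex of `T`. -/
def naturalEntrance (S : StructuredMatching G f) (T : Trail G) (k : Fin (T.length + 1))
    (A : Finset V) : Mark :=
  T.entrance A (fun g => if g = S.η A then .b else .p) k

open Classical in
/-- The entrance sequence of petalevels shortened with respect to the collection `𝒯`, at the
`k`-th vertex of `T`. -/
def shortenedEntrance (S : StructuredMatching G f) (𝒯 : Set (Trail G)) (T : Trail G)
    (k : Fin (T.length + 1)) (A : Finset V) : Mark :=
  T.entrance A (fun _ => if ∃ T' ∈ 𝒯, T'.EntersOn A (S.η A) then .b else .p) k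

end Trail

end

end FMatching

open FMatching

/-!
Along an edge `e` from `u` to `v`, the values at `φ` cancel in the difference
`l_{j̄}(u) + 1 - l_j(v)`, and what remains is compared with `ŷz(e)` one positive blossom `A` at a
time. If `A` contains both ends, the mark of `A` is the same at `u` and `v`, so `A` contributes
`z(A)` exactly once to the petalevels, as it does to `ŷz(e)`. If `e` crosses the boundary of `A`,
then `A` contributes to `ŷz(e)` according to whether `e = η(A)`, and to the petalevels according to
the mark of `A` at the end of `e` inside `A`. The two agree unless `e ≠ η(A)` and the mark is `p`
when `e` leaves `A`, or `b` when `e` enters `A`. Calling the total `z`-value of these exceptional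
blossoms the *excess*, one gets (`petalevel_opp_add_one_sub`)

  `l_{j̄}(u) + 1 - l_j(v) = |ŷz(e) - w(e)| + excess`,

the absolute value being `ŷz(e) - w(e)` for unmatched and `w(e) - ŷz(e)` for matched `e`. Both
terms are nonnegative, which gives the inequality, and equality means that `e` is tight and that
the excess vanishes.

The identity needs marks that are *compatible* with `e` (`CompatibleMarks`). The essential
condition is that a blossom left on its base edge has mark `p`. For natural marks it holds because
a trail that has entered `A` on `η(A)` cannot use this edge again; for shortened marks, because no
other trail of the collection can use it either.
-/

namespace FMatching

variable {V E : Type*}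

/-! ### Edges and vertex sets -/

theorem spanned_iff {G : Graph V E} {e : E} {u v : V} (h : G.IsLink e u v) (X : Finset V) :
    Spanned G e X ↔ u ∈ X ∧ v ∈ X := by
  constructor
  · rintro ⟨x, y, hxy, hx, hy⟩
    rcases h.eq_and_eq_or_eq_and_eq hxy with ⟨rfl, rfl⟩ | ⟨rfl, rfl⟩
    exacts [⟨hx, hy⟩, ⟨hy, hx⟩]
  · rintro ⟨hu, hv⟩
    exact ⟨u, v, h, hu, hv⟩

theorem leaves_iff {G : Graph V E} {e : E} {u v : V} (h : G.IsLink e u v) (X : Finset V) :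
    Leaves G e X ↔ (u ∈ X ∧ v ∉ X) ∨ (u ∉ X ∧ v ∈ X) := by
  constructor
  · rintro ⟨x, y, hxy, hx, hy⟩
    rcases h.eq_and_eq_or_eq_and_eq hxy with ⟨rfl, rfl⟩ | ⟨rfl, rfl⟩
    exacts [.inl ⟨hx, hy⟩, .inr ⟨hy, hx⟩]
  · rintro (⟨hu, hv⟩ | ⟨hu, hv⟩)
    exacts [⟨u, v, h, hu, hv⟩, ⟨v, u, h.symm, hv, hu⟩]

theorem Node.base_mem_verts (B : Node V E) : B.base ∈ B.verts := by
  induction B with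
  | atom v => simp [Node.base, Node.verts]
  | contract n node edge ih =>
    simp only [Node.base, Node.verts, Finset.mem_biUnion]
    exact ⟨0, Finset.mem_univ _, ih 0⟩

namespace StructuredMatching

variable [Fintype V] {G : Graph V E} {f : V → ℕ}

theorem leaves_of_η_eq (S : StructuredMatching G f) {A : Finset V} (hA : 0 < S.z A) {e : E}
    (he : S.η A = Sum.inl e) : Leaves G e A := by
  obtain ⟨B, hB, rfl⟩ := S.blossom_of_pos A hA
  by_cases hfree : IsFree G f S.M B.base
  · have h := (S.η_of_free B hB hfree).1
    simp [he] at h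
  · obtain ⟨e', x, hη, hlink, hx, -⟩ := S.η_of_not_free B hB hfree
    obtain rfl : e = e' := Sum.inl_injective (he.symm.trans hη)
    exact ⟨_, x, hlink, B.base_mem_verts, hx⟩

/-! ### Marks at the two ends of an edge -/

/-- The marks `ι` at `u` and `ι'` at `v` are compatible with advancing on
the edge `e` from `u` to `v`: the mark of a blossom is kept inside it, it is `b` if the blossom is
entered on its base edge, and `p` if the blossom is left on its base edge. -/
structure CompatibleMarks (S : StructuredMatching G f) (e : E) (u v : V)
    (ι ι' : Finset V → Mark) : Prop where
  keep : ∀ A, u ∈ A → v ∈ A → ι' A = ι A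
  enter : ∀ A, u ∉ A → v ∈ A → S.η A = Sum.inl e → ι' A = .b
  leave : ∀ A, u ∈ A → v ∉ A → S.η A = Sum.inl e → ι A = .p

/-- The edge `e` crosses the boundary of `A` without being its base edge, and `A` has mark `p` if it
is left on `e`, or mark `b` if it is entered on `e`. -/
def IsExcess (S : StructuredMatching G f) (e : E) (u v : V) (ι ι' : Finset V → Mark)
    (A : Finset V) : Prop :=
  S.η A ≠ Sum.inl e ∧ ((u ∈ A ∧ v ∉ A ∧ ι A = .p) ∨ (u ∉ A ∧ v ∈ A ∧ ι' A = .b))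

open Classical in
/-- The total `z`-value of the blossoms whose marks disagree with their contribution to
`ŷz(e)`. -/
noncomputable def excess (S : StructuredMatching G f) (e : E) (u v : V)
    (ι ι' : Finset V → Mark) : ℝ :=
  ∑ A : Finset V, if S.IsExcess e u v ι ι' A then S.z A else 0

variable {S : StructuredMatching G f} {e : E} {u v : V} {ι ι' : Finset V → Mark}

theorem excess_nonneg : 0 ≤ S.excess e u v ι ι' := by
  classical
  refine Finset.sum_nonneg fun A _ => ?_
  split_ifs
  exacts [S.z_nonneg A, le_rfl]

theorem excess_eq_zero_iff :
    S.excess e u v ι ι' = 0 ↔ ∀ A, 0 < S.z A → ¬ S.IsExcess e u v ι ι' A := by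
  classical
  rw [excess, Finset.sum_eq_zero_iff_of_nonneg fun A _ => by
    split_ifs
    exacts [S.z_nonneg A, le_rfl]]
  refine ⟨fun h A hA hex => hA.ne' (by simpa [hex] using h A (Finset.mem_univ A)),
    fun h A _ => ?_⟩
  split_ifs with hex
  · exact ((S.z_nonneg A).eq_or_lt.resolve_right fun hA => h A hA hex).symm
  · rfl

/-- The contributions of the blossoms to both sides of the petalevel inequality on an unmatched
edge. -/
theorem zMark_add_zMark_of_notMem (hlink : G.IsLink e u v) (he : e ∉ S.M)
    (hι : S.CompatibleMarks e u v ι ι') :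
    S.y u + S.y v + (S.zMark .b v ι' + S.zMark .p u ι) =
      yzHat G S.M S.η S.y S.z e u v + S.excess e u v ι ι' := by
  classical
  rw [yzHat, excess, add_assoc (S.y u + S.y v), zMark, zMark, ← Finset.sum_add_distrib,
    ← Finset.sum_add_distrib]
  congr 1
  refine Finset.sum_congr rfl fun A _ => ?_
  rcases (S.z_nonneg A).eq_or_lt with hz | hz
  · simp [← hz]
  have hη : S.η A = Sum.inl e → (u ∈ A ∧ v ∉ A) ∨ (u ∉ A ∧ v ∈ A) :=
    fun h => (leaves_iff hlink A).1 (S.leaves_of_η_eq hz h)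
  have hk := hι.keep A
  have hn := hι.enter A
  have hl := hι.leave A
  simp only [spanned_iff hlink, InI, leaves_iff hlink, IsExcess, Xor]
  -- What remains is propositional in the positions of `u` and `v`, the base edge and the marks.
  have hu' : ι A = .b ∨ ι A = .p := by cases ι A <;> simp
  have hv' : ι' A = .b ∨ ι' A = .p := by cases ι' A <;> simp
  by_cases hu : u ∈ A <;> by_cases hv : v ∈ A <;> by_cases h : S.η A = Sum.inl e <;>
    rcases hu' with hu' | hu' <;> rcases hv' with hv' | hv' <;> simp_all

/-- The contributions of the blossoms to both sides of the petalevel inequality on a matched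
edge. -/
theorem zMark_add_zMark_of_mem (hlink : G.IsLink e u v) (he : e ∈ S.M)
    (hι : S.CompatibleMarks e u v ι ι') :
    S.y u + S.y v + (S.zMark .p v ι' + S.zMark .b u ι) + S.excess e u v ι ι' =
      yzHat G S.M S.η S.y S.z e u v := by
  classical
  rw [yzHat, excess, add_assoc (S.y u + S.y v), zMark, zMark, ← Finset.sum_add_distrib,
    ← Finset.sum_add_distrib]
  congr 1
  refine Finset.sum_congr rfl fun A _ => ?_
  rcases (S.z_nonneg A).eq_or_lt with hz | hz
  · simp [← hz]
  have hη : S.η A = Sum.inl e → (u ∈ A ∧ v ∉ A) ∨ (u ∉ A ∧ v ∈ A) :=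
    fun h => (leaves_iff hlink A).1 (S.leaves_of_η_eq hz h)
  have hk := hι.keep A
  have hn := hι.enter A
  have hl := hι.leave A
  simp only [spanned_iff hlink, InI, leaves_iff hlink, IsExcess, Xor]
  -- What remains is propositional in the positions of `u` and `v`, the base edge and the marks.
  have hu' : ι A = .b ∨ ι A = .p := by cases ι A <;> simp
  have hv' : ι' A = .b ∨ ι' A = .p := by cases ι' A <;> simp
  by_cases hu : u ∈ A <;> by_cases hv : v ∈ A <;> by_cases h : S.η A = Sum.inl e <;>
    rcases hu' with hu' | hu' <;> rcases hv' with hv' | hv' <;> simp_all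

/-! ### Petalevels along an edge -/

/-- The slack of the petalevel inequality is that of the dual constraint of the edge plus the
excess. -/
theorem petalevel_opp_add_one_sub (φ : V) (hlink : G.IsLink e u v)
    (hι : S.CompatibleMarks e u v ι ι') :
    S.petalevel φ (S.ioType e).opp u ι + 1 - S.petalevel φ (S.ioType e) v ι' =
      |yzHat G S.M S.η S.y S.z e u v - weight S.M e| + S.excess e u v ι ι' := by
  by_cases he : e ∈ S.M
  · rw [abs_of_nonpos (sub_nonpos.2 (S.underrated e u v hlink he))]
    have h := zMark_add_zMark_of_mem hlink he hι
    simp only [ioType, he, if_true, IOType.opp, petalevel, weight]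
    linarith
  · rw [abs_of_nonneg (sub_nonneg.2 (S.dominated e u v hlink he))]
    have h := zMark_add_zMark_of_notMem hlink he hι
    simp only [ioType, he, if_false, IOType.opp, petalevel, weight]
    linarith

theorem petalevel_le (φ : V) (hlink : G.IsLink e u v) (hι : S.CompatibleMarks e u v ι ι') :
    S.petalevel φ (S.ioType e) v ι' ≤ S.petalevel φ (S.ioType e).opp u ι + 1 := by
  rw [← sub_nonneg, petalevel_opp_add_one_sub φ hlink hι]
  exact add_nonneg (abs_nonneg _) excess_nonneg

theorem petalevel_eq_iff (φ : V) (hlink : G.IsLink e u v) (hι : S.CompatibleMarks e u v ι ι') :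
    S.petalevel φ (S.ioType e) v ι' = S.petalevel φ (S.ioType e).opp u ι + 1 ↔
      S.IsTight e u v ∧ ∀ A, 0 < S.z A → ¬ S.IsExcess e u v ι ι' A := by
  rw [eq_comm, ← sub_eq_zero, petalevel_opp_add_one_sub φ hlink hι,
    add_eq_zero_iff_of_nonneg (abs_nonneg _) excess_nonneg, abs_eq_zero, sub_eq_zero,
    excess_eq_zero_iff, IsTight]

end StructuredMatching

/-! ### Entrance sequences along trails -/

namespace Trail

variable {G : Graph V E}

theorem entrance_zero (T : Trail G) (A : Finset V) (new : E ⊕ V → Mark) :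
    T.entrance A new 0 = new (Sum.inr (T.vert 0)) :=
  rfl

theorem entrance_succ_of_mem (T : Trail G) {A : Finset V} (new : E ⊕ V → Mark)
    {k : Fin T.length} (h : T.vert k.castSucc ∈ A) :
    T.entrance A new k.succ = T.entrance A new k.castSucc := by
  rw [entrance, Fin.induction_succ, if_pos h]

theorem entrance_succ_of_notMem (T : Trail G) {A : Finset V} (new : E ⊕ V → Mark)
    {k : Fin T.length} (h : T.vert k.castSucc ∉ A) :
    T.entrance A new k.succ = new (Sum.inl (T.edge k)) := by
  rw [entrance, Fin.induction_succ, if_neg h]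

theorem entrance_const (T : Trail G) (A : Finset V) (m : Mark) (k : Fin (T.length + 1)) :
    T.entrance A (fun _ => m) k = m := by
  induction k using Fin.induction with
  | zero => exact T.entrance_zero A _
  | succ i ih =>
    by_cases h : T.vert i.castSucc ∈ A
    · rw [T.entrance_succ_of_mem _ h, ih]
    · rw [T.entrance_succ_of_notMem _ h]

/-- The entrance value was assigned either at the start of the trail or by an earlier edge. -/
theorem entrance_eq_new (T : Trail G) (A : Finset V) (new : E ⊕ V → Mark)
    (k : Fin (T.length + 1)) :
    T.entrance A new k = new (Sum.inr (T.vert 0)) ∨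
      ∃ i : Fin T.length, i.castSucc < k ∧ T.entrance A new k = new (Sum.inl (T.edge i)) := by
  induction k using Fin.induction with
  | zero => exact .inl (T.entrance_zero A new)
  | succ i ih =>
    by_cases h : T.vert i.castSucc ∈ A
    · rw [T.entrance_succ_of_mem new h]
      exact ih.imp_right fun ⟨l, hl, hl'⟩ => ⟨l, hl.trans i.castSucc_lt_succ, hl'⟩
    · exact .inr ⟨i, i.castSucc_lt_succ, T.entrance_succ_of_notMem new h⟩

variable [Fintype V] {f : V → ℕ}

theorem compatibleMarks_naturalEntrance (S : StructuredMatching G f) (T : Trail G)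
    (k : Fin T.length) :
    S.CompatibleMarks (T.edge k) (T.vert k.castSucc) (T.vert k.succ)
      (T.naturalEntrance S k.castSucc) (T.naturalEntrance S k.succ) where
  keep A hu _ := T.entrance_succ_of_mem _ hu
  enter A hu _ hη := by
    rw [naturalEntrance, T.entrance_succ_of_notMem _ hu, if_pos hη.symm]
  leave A _ _ hη := by
    rw [naturalEntrance]
    -- The mark stems from the artificial edge or from an edge before `edge k`; neither is `η A`.
    rcases T.entrance_eq_new A (fun g => open Classical in if g = S.η A then Mark.b else .p)
      k.castSucc with h | ⟨i, hi, h⟩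
    · rw [h, if_neg (by simp [hη])]
    · refine h.trans (if_neg fun hi' => ?_)
      rw [hη] at hi'
      exact absurd (T.edge_injective (Sum.inl_injective hi')) (Fin.castSucc_lt_castSucc_iff.1 hi).ne

/-- A natural mark at the inner end of an edge entering `A` is `b` only on the base edge, so only
blossoms that are left can contribute to the excess. -/
theorem isExcess_naturalEntrance_iff (S : StructuredMatching G f) (T : Trail G)
    (k : Fin T.length) (A : Finset V) :
    S.IsExcess (T.edge k) (T.vert k.castSucc) (T.vert k.succ)
        (T.naturalEntrance S k.castSucc) (T.naturalEntrance S k.succ) A ↔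
      S.η A ≠ Sum.inl (T.edge k) ∧ T.vert k.castSucc ∈ A ∧ T.vert k.succ ∉ A ∧
        T.naturalEntrance S k.castSucc A = .p := by
  refine and_congr_right fun hη => or_iff_left ?_
  rintro ⟨hu, -, h⟩
  rw [naturalEntrance, T.entrance_succ_of_notMem _ hu, if_neg (Ne.symm hη)] at h
  cases h

open Classical in
theorem shortenedEntrance_eq (S : StructuredMatching G f) (𝒯 : Set (Trail G)) (T : Trail G)
    (k : Fin (T.length + 1)) (A : Finset V) :
    T.shortenedEntrance S 𝒯 k A = if ∃ T' ∈ 𝒯, T'.EntersOn A (S.η A) then .b else .p :=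
  T.entrance_const A _ k

theorem compatibleMarks_shortenedEntrance (S : StructuredMatching G f) {𝒯 : Set (Trail G)}
    (h𝒯 : 𝒯.Pairwise fun T T' => Disjoint (Set.range T.edge) (Set.range T'.edge))
    {T : Trail G} (hT : T ∈ 𝒯) (k : Fin T.length) :
    S.CompatibleMarks (T.edge k) (T.vert k.castSucc) (T.vert k.succ)
      (T.shortenedEntrance S 𝒯 k.castSucc) (T.shortenedEntrance S 𝒯 k.succ) where
  keep A _ _ := by rw [shortenedEntrance_eq, shortenedEntrance_eq]
  enter A hu hv hη := by
    rw [shortenedEntrance_eq, if_pos ⟨T, hT, .inr ⟨k, hη, hu, hv⟩⟩]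
  leave A hu _ hη := by
    rw [shortenedEntrance_eq, if_neg]
    rintro ⟨T', hT', ⟨h, -⟩ | ⟨i, h, hi, -⟩⟩
    · simp [hη] at h
    · have hedge : T.edge k = T'.edge i := Sum.inl_injective (hη.symm.trans h)
      obtain rfl : T = T' := by
        by_contra hne
        exact Set.disjoint_left.1 (h𝒯 hT hT' hne) ⟨k, rfl⟩ ⟨i, hedge.symm⟩
      obtain rfl := T.edge_injective hedge
      exact hi hu

end Trail

end FMatching

open FMatching
theorem mainTheorem4 {V E : Type*} [Fintype V] (G : Graph V E) (f : V → ℕ)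
    (S : StructuredMatching G f) (φ : V) (hφ : IsFree G f S.M φ) :
    -- natural petalevels
    (∀ T : Trail G, T.IsAugmenting f S.M → ∀ k : Fin T.length,
      ∀ (u v : V) (e : E) (j : IOType), u = T.vert k.castSucc → v = T.vert k.succ →
        e = T.edge k → j = S.ioType e →
        S.petalevel φ j v (T.naturalEntrance S k.succ) ≤
            S.petalevel φ j.opp u (T.naturalEntrance S k.castSucc) + 1 ∧
        (S.petalevel φ j v (T.naturalEntrance S k.succ) =
            S.petalevel φ j.opp u (T.naturalEntrance S k.castSucc) + 1 ↔
          S.IsTight e u v ∧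
            ∀ A : Finset V, 0 < S.z A → u ∈ A → v ∉ A →
              T.naturalEntrance S k.castSucc A = Mark.b ∨ S.η A = Sum.inl e)) ∧
    -- shortened petalevels
    (∀ 𝒯 : Set (Trail G), (∀ T ∈ 𝒯, T.IsAugmenting f S.M) →
      𝒯.Pairwise (fun T T' => Disjoint (Set.range T.edge) (Set.range T'.edge)) →
      ∀ T ∈ 𝒯, ∀ k : Fin T.length,
      ∀ (u v : V) (e : E) (j : IOType), u = T.vert k.castSucc → v = T.vert k.succ →
        e = T.edge k → j = S.ioType e →
        S.petalevel φ j v (T.shortenedEntrance S 𝒯 k.succ) ≤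
          S.petalevel φ j.opp u (T.shortenedEntrance S 𝒯 k.castSucc) + 1) := by
  refine ⟨?_, ?_⟩
  · rintro T - k _ _ _ _ rfl rfl rfl rfl
    have hι := T.compatibleMarks_naturalEntrance S k
    refine ⟨S.petalevel_le φ (T.isLink k) hι, ?_⟩
    rw [S.petalevel_eq_iff φ (T.isLink k) hι]
    refine and_congr_right fun _ => forall₂_congr fun A _ => ?_
    rw [T.isExcess_naturalEntrance_iff]
    cases T.naturalEntrance S k.castSucc A <;> simp; tauto
  · rintro 𝒯 - h𝒯 T hT k _ _ _ _ rfl rfl rfl rfl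
    exact S.petalevel_le φ (T.isLink k) (T.compatibleMarks_shortenedEntrance S h𝒯 hT k)
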